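/- For a field $K$ and a finite group $G$, let $G$ act on the rational function field $K(x(g) : g\in G)$ by $K$-automorphisms via $h\cdot x(g)=x(hg)$, and denote by $K(G)=K(x(g):g\in G)^G$ the fixed field. Theorem 1.4. Let $K$ be any field and let $\widetilde G=(\mathbb Z/2\mathbb Z)\times G$, where $G$ is a finite group. Then $K(\widetilde G)$ is rational over $K(G)$; that is, there is an injective $K$-linear homomorphism of fields $\varphi: K(G)\to K(\widetilde G)$ such that $K(\widetilde G)=\varphi(K(G))(t_1,\dots,t_n)$ for some $n \ge 0$ and some elements $t_1,\dots,t_n\in K(\widetilde G)$ that are algebraically independent over $\varphi(K(G))$. -/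

import Mathlib

/-- The rational function field `K(x(g) : g ∈ G)`. -/
abbrev RegularFunctionField (K G : Type*) [Field K] : Type _ :=
  FractionRing (MvPolynomial G K)

/-- `G` acts on `K[x(g) : g ∈ G]` by `K`-algebra automorphisms, `h · x(g) = x(hg)`. -/
noncomputable def regularPolynomialAction (K G : Type*) [Field K] [Group G] :
    G →* (MvPolynomial G K ≃ₐ[K] MvPolynomial G K) where
  toFun h := MvPolynomial.renameEquiv K (Equiv.mulLeft h)
  map_one' := by
    ext g
    simp
  map_mul' h k := by
    ext g
    simp [mul_assoc]

/-- The induced action of `G` on `K(x(g) : g ∈ G)` by `K`-automorphisms. -/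
noncomputable def regularFieldAction (K G : Type*) [Field K] [Group G] :
    G →* Gal(RegularFunctionField K G/K) :=
  (IsFractionRing.fieldEquivOfAlgEquivHom K (RegularFunctionField K G)).comp
    (regularPolynomialAction K G)

/-- The action on the generators is the left translation. -/
theorem regularFieldAction_apply_X (K G : Type*) [Field K] [Group G] (h g : G) :
    regularFieldAction K G h
        (algebraMap (MvPolynomial G K) (RegularFunctionField K G) (MvPolynomial.X g)) =
      algebraMap (MvPolynomial G K) (RegularFunctionField K G) (MvPolynomial.X (h * g)) := by
  simp [regularFieldAction, regularPolynomialAction]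

/-- Noether's field `K(G) = K(x(g) : g ∈ G)^G`, an intermediate field of `K(x(g) : g ∈ G)/K`. -/
noncomputable def noetherField (K G : Type*) [Field K] [Group G] :
    IntermediateField K (RegularFunctionField K G) :=
  IntermediateField.fixedField (regularFieldAction K G).range

/-- Membership in `K(G)` is invariance under every element of `G`. -/
theorem mem_noetherField_iff (K G : Type*) [Field K] [Group G] (f : RegularFunctionField K G) :
    f ∈ noetherField K G ↔ ∀ h : G, regularFieldAction K G h f = f := by
  simp [noetherField, IntermediateField.mem_fixedField_iff]

/-- The extension `L/F` is rational, that is, purely transcendental of finite transcendence degree: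
`L = F(t₁, …, tₙ)` with `t₁, …, tₙ` algebraically independent over `F`. -/
def IsRationalExtension (F L : Type*) [Field F] [Field L] [Algebra F L] : Prop :=
  ∃ (n : ℕ) (t : Fin n → L),
    AlgebraicIndependent F t ∧ IntermediateField.adjoin F (Set.range t) = ⊤

/-! Write x(g), y(g) for the indeterminates on the two cosets of G in the doubled group, u = x + y,
X = ∑ x(g), Y = ∑ y(g). The embedding is x(g) ↦ u(g), which is equivariant because u is fixed by the
swap x ↔ y. The new generators are t₀ = XY and tᵢ = (X·∑ uⁱy − Y·∑ uⁱx)/(X − Y) for 0 < i < |G|, all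
invariant under the doubled group.

Once X is adjoined to K(u, t), each tᵢ gives a linear equation for ∑ uⁱx, and interpolation at the
distinct nodes u(g) recovers every x(g) (`mem_of_swapGenerator_mem`). Since X is a root of z² − (∑
u)z + t₀, the full field is algebraic over K(u, t), and counting 2|G| elements makes (t, u)
independent. Generation is a degree count: over N = φ(K(G))(t) the full field has degree at most
2|G|, which by Artin is its degree over the fixed field containing N. -/

open Module

/-! ### Swap-invariant generators and interpolation. -/

section Generators

variable {ι L : Type*} [Fintype ι] [Field L]

/-- The weighted power sum `∑ u(g)ⁱ z(g)`. -/
def weightedPowerSum (u z : ι → L) (i : ℕ) : L := ∑ g, u g ^ i * z g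

theorem weightedPowerSum_zero (u z : ι → L) : weightedPowerSum u z 0 = ∑ g, z g := by
  simp [weightedPowerSum]

/-- The weighted power sums determine the weights, by Lagrange interpolation at the nodes `u`. -/
theorem mem_of_weightedPowerSum_mem (S : Subfield L) {u z : ι → L} (hu : Function.Injective u)
    (huS : ∀ g, u g ∈ S) (hz : ∀ i < Fintype.card ι, weightedPowerSum u z i ∈ S) (g : ι) :
    z g ∈ S := by
  classical
  -- Nodes taken in `S` give Lagrange basis polynomials with coefficients in `S`.
  let v : ι → S := fun g ↦ ⟨u g, huS g⟩
  have hv : Set.InjOn v (Finset.univ : Finset ι) :=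
    fun a _ b _ hab ↦ hu (congrArg Subtype.val hab)
  let p := Lagrange.basis Finset.univ v g
  have hdeg : p.natDegree < Fintype.card ι := by
    have : 0 < Fintype.card ι := Fintype.card_pos_iff.mpr ⟨g⟩
    rw [Lagrange.natDegree_basis hv (Finset.mem_univ g), Finset.card_univ]
    omega
  have heval (h : ι) :
      ∑ i ∈ Finset.range (Fintype.card ι), (p.coeff i : L) * u h ^ i = if h = g then 1 else 0 := by
    have h1 : p.eval (v h) = if h = g then 1 else 0 := by
      split_ifs with hh
      · rw [hh]
        exact Lagrange.eval_basis_self hv (Finset.mem_univ g)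
      · exact Lagrange.eval_basis_of_ne (Ne.symm hh) (Finset.mem_univ h)
    rw [Polynomial.eval_eq_sum_range' hdeg] at h1
    have h2 := congrArg S.subtype h1
    rw [map_sum] at h2
    simp only [map_mul, map_pow, apply_ite S.subtype, map_one, map_zero] at h2
    exact h2
  have hsum : ∑ i ∈ Finset.range (Fintype.card ι), (p.coeff i : L) * weightedPowerSum u z i
      = z g := by
    simp only [weightedPowerSum, Finset.mul_sum, ← mul_assoc]
    rw [Finset.sum_comm]
    simp only [← Finset.sum_mul, heval]
    simp
  rw [← hsum]
  exact S.sum_mem fun i hi ↦ S.mul_mem (p.coeff i).2 (hz i (Finset.mem_range.mp hi))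

/-- Elements generating the fixed field of the swap `x ↔ y` over the field generated by the
`x(g) + y(g)`. -/
def swapGenerator (x y : ι → L) : ℕ → L
  -- The quotient formula below would vanish at index 0, so the product takes its place.
  | 0 => (∑ g, x g) * ∑ g, y g
  | i + 1 => ((∑ g, x g) * weightedPowerSum (x + y) y (i + 1) -
      (∑ g, y g) * weightedPowerSum (x + y) x (i + 1)) / (∑ g, x g - ∑ g, y g)

theorem map_weightedPowerSum {L' : Type*} [Field L'] (f : L →+* L') (u z : ι → L) (i : ℕ) :
    f (weightedPowerSum u z i) = weightedPowerSum (f ∘ u) (f ∘ z) i := by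
  simp [weightedPowerSum]

theorem weightedPowerSum_comp_equiv (e : ι ≃ ι) (u z : ι → L) (i : ℕ) :
    weightedPowerSum (u ∘ e) (z ∘ e) i = weightedPowerSum u z i :=
  Equiv.sum_comp e fun g ↦ u g ^ i * z g

theorem map_swapGenerator {L' : Type*} [Field L'] (f : L →+* L') (x y : ι → L) (i : ℕ) :
    f (swapGenerator x y i) = swapGenerator (f ∘ x) (f ∘ y) i := by
  have h : f ∘ (x + y) = f ∘ x + f ∘ y := by ext; simp
  cases i <;> simp [swapGenerator, map_weightedPowerSum, h]

theorem swapGenerator_comp_equiv (e : ι ≃ ι) (x y : ι → L) (i : ℕ) :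
    swapGenerator (x ∘ e) (y ∘ e) i = swapGenerator x y i := by
  have h : x ∘ e + y ∘ e = (x + y) ∘ e := rfl
  cases i <;> simp [swapGenerator, h, weightedPowerSum_comp_equiv, Equiv.sum_comp e x,
    Equiv.sum_comp e y]

/-- Numerator and denominator both change sign under the swap. -/
theorem swapGenerator_comm (x y : ι → L) (i : ℕ) : swapGenerator y x i = swapGenerator x y i := by
  cases i with
  | zero => exact mul_comm _ _
  | succ i => rw [swapGenerator, swapGenerator, add_comm y x, ← neg_div_neg_eq, neg_sub, neg_sub]

theorem mem_of_swapGenerator_mem (S : Subfield L) {x y : ι → L}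
    (hu : Function.Injective (x + y)) (hsum : ∑ g, x g + ∑ g, y g ≠ 0)
    (hsub : ∑ g, x g - ∑ g, y g ≠ 0) (huS : ∀ g, x g + y g ∈ S)
    (ht : ∀ i < Fintype.card ι, swapGenerator x y i ∈ S) (hx : ∑ g, x g ∈ S) (g : ι) :
    x g ∈ S ∧ y g ∈ S := by
  have hxg : x g ∈ S := by
    refine mem_of_weightedPowerSum_mem S hu huS (fun i hi ↦ ?_) g
    have hc (j : ℕ) : weightedPowerSum (x + y) x j + weightedPowerSum (x + y) y j ∈ S := by
      simp only [weightedPowerSum, ← Finset.sum_add_distrib, ← mul_add]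
      exact S.sum_mem fun g _ ↦ S.mul_mem (S.pow_mem (huS g) _) (huS g)
    have hc0 : ∑ g, x g + ∑ g, y g ∈ S := by
      simpa only [weightedPowerSum_zero] using hc 0
    have hy : ∑ g, y g ∈ S := by simpa using S.sub_mem hc0 hx
    cases i with
    | zero => rwa [weightedPowerSum_zero]
    | succ i =>
      -- Solve the 2 × 2 linear system a + b = c, Xb − Ya = t(X − Y) for a; its determinant is X + Y
      -- up to sign.
      have key : weightedPowerSum (x + y) x (i + 1) =
          ((∑ g, x g) * (weightedPowerSum (x + y) x (i + 1) + weightedPowerSum (x + y) y (i + 1)) -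
            swapGenerator x y (i + 1) * (∑ g, x g - ∑ g, y g)) / (∑ g, x g + ∑ g, y g) := by
        rw [eq_div_iff hsum, swapGenerator, div_mul_cancel₀ _ hsub]
        ring
      rw [key]
      exact S.div_mem (S.sub_mem (S.mul_mem hx (hc _)) (S.mul_mem (ht _ hi) (S.sub_mem hx hy))) hc0
  exact ⟨hxg, by simpa using S.sub_mem (huS g) hxg⟩

end Generators

/-! ### Degree bounds and Artin's theorem. -/

section Degree

/-- If `L` is generated over `N` by a root of a quadratic polynomial together with the image of a
field `E`, finite over a subfield `M` that maps into `N`, then `[L : N] ≤ 2 [E : M]`. -/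
theorem finrank_le_two_mul_of_generators {M E N L : Type*} [Field M] [Field E] [Field N] [Field L]
    [Algebra M E] [Algebra N L] [FiniteDimensional M E] (f : E →+* L) (i : M →+* N)
    (hi : ∀ m, algebraMap N L (i m) = f (algebraMap M E m)) (z : L) (c : E) (d : N)
    (hz : z ^ 2 - f c * z + algebraMap N L d = 0)
    (htop : ∀ S : Subfield L, (∀ a, algebraMap N L a ∈ S) → (∀ a, f a ∈ S) → z ∈ S → S = ⊤) :
    FiniteDimensional N L ∧ finrank N L ≤ 2 * finrank M E := by
  let _ : Algebra M N := i.toAlgebra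
  let _ : Algebra M L := ((algebraMap N L).comp i).toAlgebra
  have : IsScalarTower M N L := .of_algebraMap_eq fun _ ↦ rfl
  let fM : E →ₐ[M] L := { f with commutes' := fun m ↦ (hi m).symm }
  let e : E ≃ₐ[M] fM.fieldRange := AlgEquiv.ofInjectiveField fM
  have : FiniteDimensional M fM.fieldRange := e.toLinearEquiv.finiteDimensional
  let P : IntermediateField N L := IntermediateField.adjoin N (fM.fieldRange : Set L)
  have hPE (a : E) : f a ∈ P := IntermediateField.subset_adjoin _ _ ⟨a, rfl⟩
  have hrank : Module.rank N P ≤ finrank M E := by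
    rw [e.toLinearEquiv.finrank_eq, finrank_eq_rank]
    exact IntermediateField.adjoin_rank_le_of_isAlgebraic_right N fM.fieldRange
  have : FiniteDimensional N P :=
    Module.rank_lt_aleph0_iff.mp (hrank.trans_lt (Cardinal.natCast_lt_aleph0))
  have hP : finrank N P ≤ finrank M E := by
    rw [← finrank_eq_rank] at hrank
    exact_mod_cast hrank
  let q : Polynomial P := Polynomial.X ^ 2 - Polynomial.C ⟨f c, hPE c⟩ * Polynomial.X +
    Polynomial.C (algebraMap N P d)
  have hq : q.natDegree = 2 := by simp only [q]; compute_degree!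
  have hqm : q.Monic := by simp only [q]; monicity!
  have hqz : Polynomial.aeval z q = 0 := by
    simp only [q, map_add, map_sub, map_mul, map_pow, Polynomial.aeval_X, Polynomial.aeval_C]
    exact hz
  have hint : IsIntegral P z := ⟨q, hqm, hqz⟩
  have htop' : IntermediateField.adjoin P {z} = ⊤ := by
    have := htop (IntermediateField.adjoin P {z}).toSubfield
      (fun a ↦ (IntermediateField.adjoin P {z}).algebraMap_mem (algebraMap N P a))
      (fun a ↦ (IntermediateField.adjoin P {z}).algebraMap_mem ⟨f a, hPE a⟩)
      (IntermediateField.mem_adjoin_simple_self P z)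
    rw [← IntermediateField.toSubfield_inj, this]
    rfl
  have hL : finrank P L ≤ 2 := by
    rw [← IntermediateField.finrank_top' (F := P) (E := L), ← htop',
      IntermediateField.adjoin.finrank hint, ← hq]
    exact Polynomial.natDegree_le_of_dvd (minpoly.dvd P z hqz) hqm.ne_zero
  have : FiniteDimensional P L := by
    have := IntermediateField.adjoin.finiteDimensional hint
    rw [htop'] at this
    exact IntermediateField.topEquiv.toLinearEquiv.finiteDimensional
  refine ⟨FiniteDimensional.trans N P L, ?_⟩
  rw [← finrank_mul_finrank N P L, mul_comm]
  exact Nat.mul_le_mul hL hP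

/-- Artin's theorem for the fixed field of a faithful finite group of automorphisms. -/
theorem finrank_fixedField_range {K L H : Type*} [Field K] [Field L] [Algebra K L] [Group H]
    [Finite H] (ρ : H →* Gal(L/K)) (hρ : Function.Injective ρ) :
    finrank (IntermediateField.fixedField ρ.range) L = Nat.card H := by
  have : Finite ρ.range := Finite.of_surjective _ ρ.rangeRestrict_surjective
  have := Fintype.ofFinite ρ.range
  rw [Nat.card_congr (ρ.ofInjective hρ).toEquiv, Nat.card_eq_fintype_card]
  exact FixedPoints.finrank_eq_card ρ.range L

end Degree

/-! ### The regular action on the rational function field. -/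

section Regular

variable {K G : Type*} [Field K]

/-- The indeterminate `x(g)` in the rational function field. -/
noncomputable def regularVariable (K : Type*) {G : Type*} [Field K] (g : G) :
    RegularFunctionField K G :=
  algebraMap (MvPolynomial G K) (RegularFunctionField K G) (MvPolynomial.X g)

theorem algebraicIndependent_regularVariable :
    AlgebraicIndependent K (regularVariable K : G → RegularFunctionField K G) :=
  (MvPolynomial.algebraicIndependent_X G K).map'
    (f := IsScalarTower.toAlgHom K (MvPolynomial G K) (RegularFunctionField K G))
    (IsFractionRing.injective _ _)

theorem regularVariable_injective :
    Function.Injective (regularVariable K : G → RegularFunctionField K G) :=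
  algebraicIndependent_regularVariable.injective

theorem algHom_regularFunctionField_ext {L : Type*} [Field L] [Algebra K L]
    {f₁ f₂ : RegularFunctionField K G →ₐ[K] L}
    (h : ∀ g, f₁ (regularVariable K g) = f₂ (regularVariable K g)) : f₁ = f₂ :=
  IsLocalization.algHom_ext (nonZeroDivisors (MvPolynomial G K))
    (MvPolynomial.algHom_ext fun g ↦ h g)

theorem eq_top_of_regularVariable_mem (S : Subfield (RegularFunctionField K G))
    (hK : ∀ a, algebraMap K _ a ∈ S) (hS : ∀ g, regularVariable K g ∈ S) : S = ⊤ := by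
  have hpoly (p : MvPolynomial G K) : algebraMap _ (RegularFunctionField K G) p ∈ S := by
    induction p using MvPolynomial.induction_on with
    | C a =>
      have : algebraMap (MvPolynomial G K) (RegularFunctionField K G) (MvPolynomial.C a) =
        algebraMap K _ a := (IsScalarTower.algebraMap_apply K (MvPolynomial G K) _ a).symm
      rw [this]
      exact hK a
    | add p q hp hq => rw [map_add]; exact S.add_mem hp hq
    | mul_X p g hp => rw [map_mul]; exact S.mul_mem hp (hS g)
  refine eq_top_iff.mpr fun a _ ↦ ?_
  obtain ⟨p, q, -, rfl⟩ := IsFractionRing.div_surjective (A := MvPolynomial G K) a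
  exact S.div_mem (hpoly p) (hpoly q)

theorem regularFieldAction_regularVariable [Group G] (h g : G) :
    regularFieldAction K G h (regularVariable K g) = regularVariable K (h * g) :=
  regularFieldAction_apply_X K G h g

theorem regularFieldAction_injective [Group G] :
    Function.Injective (regularFieldAction K G) := by
  intro h k hhk
  have := congrArg (fun σ ↦ σ (regularVariable K 1)) hhk
  simp only [regularFieldAction_regularVariable, mul_one] at this
  exact regularVariable_injective this

theorem finrank_noetherField [Group G] [Finite G] :
    finrank (noetherField K G) (RegularFunctionField K G) = Nat.card G :=
  finrank_fixedField_range _ regularFieldAction_injective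

end Regular

/-! ### Nondegeneracy and algebraic independence. -/

section Independence

variable {K L G : Type*} [Field K] [Field L] [Algebra K L] [Fintype G] {x y : G → L}

section Nondegenerate

variable (hxy : AlgebraicIndependent K (Sum.elim x y))

include hxy

-- A relation among independent elements is a polynomial identity, so it can be refuted at one
-- K-point. A point with a single coordinate 1 and the rest 0 suffices below, in every
-- characteristic.
omit [Fintype G] in
theorem AlgebraicIndependent.eval_eq_of_aeval_eq {p q : MvPolynomial (G ⊕ G) K}
    (h : MvPolynomial.aeval (Sum.elim x y) p = MvPolynomial.aeval (Sum.elim x y) q)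
    (e : G ⊕ G → K) : MvPolynomial.eval e p = MvPolynomial.eval e q :=
  congrArg _ (hxy h)

omit [Fintype G] in
theorem AlgebraicIndependent.add_injective_of_sumElim : Function.Injective (x + y) := by
  classical
  intro g h hgh
  by_contra hne
  have := hxy.eval_eq_of_aeval_eq
    (p := MvPolynomial.X (Sum.inl g) + MvPolynomial.X (Sum.inr g))
    (q := MvPolynomial.X (Sum.inl h) + MvPolynomial.X (Sum.inr h))
    (by simpa using hgh) (Pi.single (Sum.inl g) 1)
  simp [Ne.symm hne] at this

theorem AlgebraicIndependent.sum_add_sum_ne_zero [Nonempty G] :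
    ∑ g, x g + ∑ g, y g ≠ 0 := by
  classical
  intro h0
  obtain ⟨g⟩ := ‹Nonempty G›
  have := hxy.eval_eq_of_aeval_eq
    (p := ∑ g, MvPolynomial.X (Sum.inl g) + ∑ g, MvPolynomial.X (Sum.inr g))
    (q := 0) (by simpa using h0) (Pi.single (Sum.inl g) 1)
  simp [Pi.single_apply] at this

theorem AlgebraicIndependent.sum_sub_sum_ne_zero [Nonempty G] :
    ∑ g, x g - ∑ g, y g ≠ 0 := by
  classical
  intro h0
  obtain ⟨g⟩ := ‹Nonempty G›
  have := hxy.eval_eq_of_aeval_eq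
    (p := ∑ g, MvPolynomial.X (Sum.inl g) - ∑ g, MvPolynomial.X (Sum.inr g))
    (q := 0) (by simpa using h0) (Pi.single (Sum.inl g) 1)
  simp [Pi.single_apply] at this

end Nondegenerate

theorem sum_quadratic_eq_zero (x y : G → L) :
    (∑ g, x g) ^ 2 - (∑ g, (x g + y g)) * (∑ g, x g) + swapGenerator x y 0 = 0 := by
  rw [swapGenerator, Finset.sum_add_distrib]
  ring

/-- If `L = K(x, y)` with `x`, `y` jointly algebraically independent, then so are the sums
`x(g) + y(g)` together with the first `|G|` swap generators. -/
theorem AlgebraicIndependent.swapGenerator [Nonempty G]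
    (hxy : AlgebraicIndependent K (Sum.elim x y))
    (htop : ∀ S : Subfield L, (∀ a, algebraMap K L a ∈ S) → (∀ g, x g ∈ S ∧ y g ∈ S) → S = ⊤) :
    AlgebraicIndependent K
      (Sum.elim (fun i : Fin (Fintype.card G) ↦ _root_.swapGenerator x y i) (x + y)) := by
  set v := Sum.elim (fun i : Fin (Fintype.card G) ↦ _root_.swapGenerator x y i) (x + y) with hv
  let F := IntermediateField.adjoin K (Set.range v)
  let S := algebraicClosure F L
  have hF {a : L} (ha : a ∈ F) : a ∈ S := S.algebraMap_mem ⟨a, ha⟩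
  have hu (g : G) : x g + y g ∈ F := IntermediateField.subset_adjoin _ _ ⟨Sum.inr g, rfl⟩
  have ht (i : ℕ) (hi : i < Fintype.card G) : _root_.swapGenerator x y i ∈ F :=
    IntermediateField.subset_adjoin _ _ ⟨Sum.inl ⟨i, hi⟩, rfl⟩
  have hX : ∑ g, x g ∈ S := by
    let q : Polynomial F := Polynomial.X ^ 2 -
      Polynomial.C ⟨∑ g, (x g + y g), sum_mem fun g _ ↦ hu g⟩ * Polynomial.X +
      Polynomial.C ⟨_, ht 0 Fintype.card_pos⟩
    have hqm : q.Monic := by simp only [q]; monicity!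
    refine mem_algebraicClosure_iff.mpr ⟨q, hqm.ne_zero, ?_⟩
    simp only [q, map_add, map_sub, map_mul, map_pow, Polynomial.aeval_X, Polynomial.aeval_C]
    exact sum_quadratic_eq_zero x y
  have hS : S.toSubfield = ⊤ := htop _ (fun a ↦ hF (F.algebraMap_mem a)) fun g ↦
    mem_of_swapGenerator_mem S.toSubfield hxy.add_injective_of_sumElim hxy.sum_add_sum_ne_zero
      hxy.sum_sub_sum_ne_zero (fun g ↦ hF (hu g)) (fun i hi ↦ hF (ht i hi)) hX g
  have halg : Algebra.IsAlgebraic F L := ⟨fun a ↦ mem_algebraicClosure_iff.mp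
    (show a ∈ S.toSubfield from hS ▸ Subfield.mem_top a)⟩
  have := IntermediateField.isAlgebraic_adjoin_iff_top.mp halg
  -- `L` is algebraic over K(v), and v has 2|G| members, no more than the transcendence degree, so v
  -- is a transcendence basis.
  refine (Algebra.IsAlgebraic.isTranscendenceBasis_of_lift_le_trdeg_of_finite K v ?_).1
  rw [Cardinal.mk_congr (Equiv.sumCongr (Fintype.equivFin G).symm (Equiv.refl G))]
  exact hxy.lift_cardinalMk_le_trdeg

end Independence

/-! ### Embeddings, descent of independence, and the degree comparison. -/

section Embedding

variable {K L G : Type*} [Field K] [Field L] [Algebra K L] {u : G → L}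

/-- The embedding of the rational function field sending `x(g)` to `u(g)`, for `u` algebraically
independent. -/
noncomputable def AlgebraicIndependent.regularFieldHom (hu : AlgebraicIndependent K u) :
    RegularFunctionField K G →ₐ[K] L :=
  (IntermediateField.val _).comp hu.aevalEquivField.toAlgHom

theorem AlgebraicIndependent.regularFieldHom_regularVariable (hu : AlgebraicIndependent K u)
    (g : G) : hu.regularFieldHom (regularVariable K g) = u g :=
  (hu.aevalEquivField_algebraMap_apply_coe (MvPolynomial.X g)).trans (MvPolynomial.aeval_X _ _)

theorem AlgebraicIndependent.regularFieldHom_mem_adjoin (hu : AlgebraicIndependent K u)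
    (a : RegularFunctionField K G) :
    hu.regularFieldHom a ∈ IntermediateField.adjoin K (Set.range u) :=
  (hu.aevalEquivField a).2

end Embedding

/-- Algebraic independence descends along an embedding of base fields and an embedding of ambient
fields. -/
theorem AlgebraicIndependent.of_fieldHom {ι F B M L : Type*} [Field F] [Field B] [Field M]
    [Field L] [Algebra F M] [Algebra M L] [Algebra F L] [IsScalarTower F M L] [Algebra B L]
    {t : ι → M} (h : AlgebraicIndependent B fun i ↦ algebraMap M L (t i)) (j : F →+* B)
    (hj : ∀ a, algebraMap B L (j a) = algebraMap F L a) : AlgebraicIndependent F t := by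
  let _ : Algebra F B := j.toAlgebra
  have : IsScalarTower F B L := .of_algebraMap_eq fun a ↦ (hj a).symm
  exact (h.restrictScalars j.injective).of_comp (IsScalarTower.toAlgHom F M L)

theorem AlgebraicIndependent.fieldRange_of_coe {ι K A L : Type*} [Field K] [Field A] [Field L]
    [Algebra K A] [Algebra K L] {M B : IntermediateField K L} (φ : A →ₐ[K] M)
    (hφ : ∀ a, (φ a : L) ∈ B) {t : ι → M} (h : AlgebraicIndependent B fun i ↦ (t i : L)) :
    AlgebraicIndependent φ.fieldRange t := by
  let F := φ.fieldRange
  have hF (a : F) : algebraMap F L a ∈ B := by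
    obtain ⟨_, a, rfl⟩ := a
    exact hφ a
  let j : F →+* B := (algebraMap F L).codRestrict B hF
  have hj (a : F) : algebraMap B L (j a) = algebraMap F L a := rfl
  exact AlgebraicIndependent.of_fieldHom (F := F) (B := B) (M := M) (L := L) (t := t) h j hj

theorem IntermediateField.eq_top_of_finrank_le {F M L : Type*} [Field F] [Field M] [Field L]
    [Algebra F M] [Algebra M L] (N : IntermediateField F M) [FiniteDimensional N L]
    (h : finrank N L ≤ finrank M L) : N = ⊤ := by
  have : FiniteDimensional N M := FiniteDimensional.left N M L
  have : FiniteDimensional M L := FiniteDimensional.right N M L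
  have hM : 0 < finrank M L := finrank_pos
  rw [← finrank_mul_finrank N M L] at h
  refine IntermediateField.finrank_eq_one_iff_eq_top.mp (le_antisymm ?_ finrank_pos)
  exact Nat.le_of_mul_le_mul_right (h.trans_eq (one_mul _).symm) hM

/-- With N = φ(A)(t) inside M, the quadratic for `z` gives [L : N] ≤ 2[E : A] = [L : M], which
forces N = M. -/
theorem adjoin_range_eq_top_of_finrank_eq {ι K A E L : Type*} [Field K] [Field A] [Field E]
    [Field L] [Algebra K A] [Algebra K L] [Algebra A E] [FiniteDimensional A E]
    {M : IntermediateField K L} (φ : A →ₐ[K] M) (f : E →+* L)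
    (hφ : ∀ a, (φ a : L) = f (algebraMap A E a)) (t : ι → M)
    (hdeg : finrank M L = 2 * finrank A E) (z : L) (c : E) (d : ι)
    (hz : z ^ 2 - f c * z + t d = 0)
    (htop : ∀ S : Subfield L, (∀ a, algebraMap K L a ∈ S) → (∀ a, f a ∈ S) →
      (∀ i, (t i : L) ∈ S) → z ∈ S → S = ⊤) :
    IntermediateField.adjoin φ.fieldRange (Set.range t) = ⊤ := by
  let N := IntermediateField.adjoin φ.fieldRange (Set.range t)
  have ht (i : ι) : t i ∈ N := IntermediateField.subset_adjoin _ _ ⟨i, rfl⟩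
  obtain ⟨hN, hle⟩ := finrank_le_two_mul_of_generators (N := N) f
    ((algebraMap φ.fieldRange N).comp (φ.toRingHom.codRestrict φ.fieldRange fun a ↦ ⟨a, rfl⟩))
    hφ z c ⟨t d, ht d⟩ hz
    fun S hNS hES hX ↦ htop S (fun a ↦ hNS (algebraMap K N a)) hES (fun i ↦ hNS ⟨t i, ht i⟩) hX
  exact N.eq_top_of_finrank_le (hle.trans_eq hdeg.symm)

/-! ### The doubled group acting on the two cosets of variables. -/

section Double

variable (K : Type*) {G : Type*} [Field K]

/-- The group of order two times `G`. -/
abbrev Doubled (G : Type*) := Multiplicative (ZMod 2) × G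

/-- The generator of the group of order two. -/
def swapElement : Multiplicative (ZMod 2) := Multiplicative.ofAdd 1

/-- The indeterminates indexed by the trivial coset of `G`. -/
noncomputable def evenVariable (g : G) : RegularFunctionField K (Doubled G) :=
  regularVariable K (1, g)

/-- The indeterminates indexed by the nontrivial coset of `G`. -/
noncomputable def oddVariable (g : G) : RegularFunctionField K (Doubled G) :=
  regularVariable K (swapElement, g)

theorem swapElement_ne_one : swapElement ≠ 1 := by decide

theorem swapElement_mul_self : swapElement * swapElement = 1 := by decide

theorem eq_one_or_eq_swapElement (a : Multiplicative (ZMod 2)) : a = 1 ∨ a = swapElement := by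
  revert a; decide

theorem algebraicIndependent_even_odd :
    AlgebraicIndependent K (Sum.elim (evenVariable K) (oddVariable K) : G ⊕ G → _) := by
  have h : (Sum.elim (evenVariable K) (oddVariable K) : G ⊕ G → _) =
      regularVariable K ∘ Sum.elim (fun g : G ↦ ((1, g) : Doubled G)) (fun g ↦ (swapElement, g)) := by
    ext (g | g) <;> rfl
  rw [h]
  refine algebraicIndependent_regularVariable.comp _ (Function.Injective.sumElim ?_ ?_ ?_)
  · exact fun a b hab ↦ congrArg Prod.snd hab
  · exact fun a b hab ↦ congrArg Prod.snd hab
  · exact fun a b hab ↦ swapElement_ne_one (congrArg Prod.fst hab).symm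

theorem eq_top_of_even_odd_mem (S : Subfield (RegularFunctionField K (Doubled G)))
    (hK : ∀ a, algebraMap K _ a ∈ S)
    (hS : ∀ g : G, evenVariable K g ∈ S ∧ oddVariable K g ∈ S) : S = ⊤ := by
  refine eq_top_of_regularVariable_mem S hK ?_
  rintro ⟨a, g⟩
  obtain rfl | rfl := eq_one_or_eq_swapElement a
  exacts [(hS g).1, (hS g).2]

variable [Group G]

theorem regularFieldAction_even_odd (h : Doubled G) :
    (∀ g : G, regularFieldAction K (Doubled G) h (evenVariable K g) = evenVariable K (h.2 * g)) ∧
      (∀ g : G, regularFieldAction K (Doubled G) h (oddVariable K g) = oddVariable K (h.2 * g)) ∨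
    (∀ g : G, regularFieldAction K (Doubled G) h (evenVariable K g) = oddVariable K (h.2 * g)) ∧
      (∀ g : G, regularFieldAction K (Doubled G) h (oddVariable K g) = evenVariable K (h.2 * g)) := by
  obtain ⟨a, h⟩ := h
  simp only [evenVariable, oddVariable, regularFieldAction_regularVariable, Prod.mk_mul_mk]
  obtain rfl | rfl := eq_one_or_eq_swapElement a
  · simp
  · simp [swapElement_mul_self]

theorem regularFieldAction_even_add_odd (h : Doubled G) (g : G) :
    regularFieldAction K (Doubled G) h (evenVariable K g + oddVariable K g) =
      evenVariable K (h.2 * g) + oddVariable K (h.2 * g) := by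
  rw [map_add]
  obtain ⟨h1, h2⟩ | ⟨h1, h2⟩ := regularFieldAction_even_odd K h
  · rw [h1, h2]
  · rw [h1, h2, add_comm]

theorem swapGenerator_mem_noetherField [Fintype G] (i : ℕ) :
    swapGenerator (evenVariable K : G → _) (oddVariable K) i ∈ noetherField K (Doubled G) := by
  refine (mem_noetherField_iff ..).mpr fun h ↦ ?_
  let σ : RegularFunctionField K (Doubled G) →+* RegularFunctionField K (Doubled G) :=
    (regularFieldAction K (Doubled G) h).toAlgHom.toRingHom
  have hσ := map_swapGenerator σ (evenVariable K : G → _) (oddVariable K) i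
  refine hσ.trans ?_
  obtain ⟨h1, h2⟩ | ⟨h1, h2⟩ := regularFieldAction_even_odd K h
  · have e1 : σ ∘ evenVariable K = evenVariable K ∘ Equiv.mulLeft h.2 := funext h1
    have e2 : σ ∘ oddVariable K = oddVariable K ∘ Equiv.mulLeft h.2 := funext h2
    rw [e1, e2, swapGenerator_comp_equiv]
  · have e1 : σ ∘ evenVariable K = oddVariable K ∘ Equiv.mulLeft h.2 := funext h1
    have e2 : σ ∘ oddVariable K = evenVariable K ∘ Equiv.mulLeft h.2 := funext h2
    rw [e1, e2, swapGenerator_comp_equiv, swapGenerator_comm]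

end Double

/-! ### The embedding of Noether fields and its generators. -/

section Main

variable (K G : Type*) [Field K] [Group G] [Fintype G]

theorem algebraicIndependent_swapGenerator_even_add_odd :
    AlgebraicIndependent K (Sum.elim
      (fun i : Fin (Fintype.card G) ↦ swapGenerator (evenVariable K : G → _) (oddVariable K) i)
      (evenVariable K + oddVariable K)) :=
  (algebraicIndependent_even_odd K).swapGenerator (eq_top_of_even_odd_mem K)

/-- The embedding `x(g) ↦ x(1, g) + x(s, g)`. -/
noncomputable def sumEmbedding :
    RegularFunctionField K G →ₐ[K] RegularFunctionField K (Doubled G) :=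
  (AlgebraicIndependent.sumElim_iff.mp
    (algebraicIndependent_swapGenerator_even_add_odd K G)).1.regularFieldHom

theorem sumEmbedding_regularVariable (g : G) :
    sumEmbedding K G (regularVariable K g) = evenVariable K g + oddVariable K g :=
  AlgebraicIndependent.regularFieldHom_regularVariable _ g

theorem sumEmbedding_mem_adjoin (a : RegularFunctionField K G) :
    sumEmbedding K G a ∈ IntermediateField.adjoin K
      (Set.range (evenVariable K + oddVariable K : G → RegularFunctionField K (Doubled G))) :=
  AlgebraicIndependent.regularFieldHom_mem_adjoin _ a

theorem regularFieldAction_sumEmbedding (h : Doubled G) (a : RegularFunctionField K G) :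
    regularFieldAction K (Doubled G) h (sumEmbedding K G a) =
      sumEmbedding K G (regularFieldAction K G h.2 a) := by
  have : (regularFieldAction K (Doubled G) h).toAlgHom.comp (sumEmbedding K G) =
      (sumEmbedding K G).comp (regularFieldAction K G h.2).toAlgHom := by
    refine algHom_regularFunctionField_ext fun g ↦ ?_
    change regularFieldAction K (Doubled G) h (sumEmbedding K G (regularVariable K g)) =
      sumEmbedding K G (regularFieldAction K G h.2 (regularVariable K g))
    rw [regularFieldAction_regularVariable, sumEmbedding_regularVariable,
      sumEmbedding_regularVariable, regularFieldAction_even_add_odd]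
  exact DFunLike.congr_fun this a

/-- The embedding of `K(G)` into the Noether field of the doubled group. -/
noncomputable def noetherFieldEmbedding :
    noetherField K G →ₐ[K] noetherField K (Doubled G) :=
  ((sumEmbedding K G).comp (noetherField K G).val).codRestrict
    (noetherField K (Doubled G)).toSubalgebra fun a ↦
      (mem_noetherField_iff ..).mpr fun h ↦
        (regularFieldAction_sumEmbedding K G h a).trans
          (congrArg _ ((mem_noetherField_iff ..).mp a.2 h.2))

/-- The swap generators as elements of the Noether field of the doubled group. -/
noncomputable def noetherGenerator (i : Fin (Fintype.card G)) : noetherField K (Doubled G) :=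
  ⟨swapGenerator (evenVariable K) (oddVariable K) i, swapGenerator_mem_noetherField K i⟩

theorem algebraicIndependent_noetherGenerator :
    AlgebraicIndependent (noetherFieldEmbedding K G).fieldRange (noetherGenerator K G) := by
  have h := (AlgebraicIndependent.sumElim_iff.mp
    (algebraicIndependent_swapGenerator_even_add_odd K G)).2
  have h' := IntermediateField.algebraicIndependent_adjoin_iff (F := K)
    (E := RegularFunctionField K (Doubled G)) |>.mpr h
  -- Independence holds over all of K(u), hence over its subfield φ(K(G)).
  refine AlgebraicIndependent.fieldRange_of_coe (noetherFieldEmbedding K G)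
    (fun a ↦ sumEmbedding_mem_adjoin K G (a : RegularFunctionField K G)) ?_
  exact h'

theorem adjoin_noetherGenerator :
    IntermediateField.adjoin (noetherFieldEmbedding K G).fieldRange
      (Set.range (noetherGenerator K G)) = ⊤ := by
  have hxy := algebraicIndependent_even_odd K (G := G)
  have hfin : finrank (noetherField K G) (RegularFunctionField K G) = Fintype.card G := by
    rw [finrank_noetherField, Nat.card_eq_fintype_card]
  have : FiniteDimensional (noetherField K G) (RegularFunctionField K G) :=
    .of_finrank_pos (hfin ▸ Fintype.card_pos)
  -- The quadratic element is X; its trace coefficient ∑ u is the image of ∑ x(g), and its constant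
  -- term is the generator of index 0.
  refine adjoin_range_eq_top_of_finrank_eq (noetherFieldEmbedding K G)
    (sumEmbedding K G).toRingHom (fun _ ↦ rfl) _ ?_ (∑ g : G, evenVariable K g)
    (∑ g, regularVariable K g) ⟨0, Fintype.card_pos⟩ ?_ fun S hKS hES htS hX ↦ ?_
  · rw [hfin, finrank_noetherField, Nat.card_prod, Nat.card_eq_fintype_card (α := G)]
    simp
  · have h : (sumEmbedding K G).toRingHom (∑ g, regularVariable K g) =
        ∑ g : G, (evenVariable K g + oddVariable K g) := by
      rw [map_sum]
      exact Finset.sum_congr rfl fun g _ ↦ sumEmbedding_regularVariable K G g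
    rw [h]
    exact sum_quadratic_eq_zero _ _
  · have hu (g : G) : evenVariable K g + oddVariable K g ∈ S := by
      rw [← sumEmbedding_regularVariable]
      exact hES _
    exact eq_top_of_even_odd_mem K S hKS fun g ↦
      mem_of_swapGenerator_mem S hxy.add_injective_of_sumElim hxy.sum_add_sum_ne_zero
        hxy.sum_sub_sum_ne_zero hu (fun i hi ↦ htS ⟨i, hi⟩) hX g

end Main

/-- For any field `K` and any finite group `G`, the field `K((ℤ/2ℤ) × G)` is rational over `K(G)`,
via some `K`-embedding `φ : K(G) → K((ℤ/2ℤ) × G)`. -/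
theorem theorem1p4 (K : Type*) [Field K] (G : Type*) [Group G] [Finite G] :
    ∃ φ : noetherField K G →ₐ[K] noetherField K (Multiplicative (ZMod 2) × G),
      IsRationalExtension φ.fieldRange (noetherField K (Multiplicative (ZMod 2) × G)) := by
  have := Fintype.ofFinite G
  exact ⟨noetherFieldEmbedding K G, Fintype.card G, noetherGenerator K G,
    algebraicIndependent_noetherGenerator K G, adjoin_noetherGenerator K G⟩
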